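/- Let $\mu$ be a Borel probability measure on $\mathbb{C}$ with compact support $S$, let $U_\mu(z)=\int_S\log|z-w|\,d\mu(w)\in[-\infty,\infty)$ be its logarithmic potential (with $\log 0=-\infty$), and let $\Omega^-=\{z\in\mathbb{C}: U_\mu(z)<0\}$. Assume that $\sup_{z\in K}\int_S(\log|z-w|)^2\,d\mu(w)<\infty$ for every compact $K\subset\mathbb{C}$, and that $\Omega^-\neq\emptyset$. Let $X_1,X_2,\dots$ be i.i.d. random variables with distribution $\mu$, let $p_n(z)=(z-X_1)\cdots(z-X_n)$ and $\Lambda_n=\{z\in\mathbb{C}:|p_n(z)|<1\}$. For $A\subset\mathbb{C}$ let the inradius $\rho(A)$ be the supremum of the radii $r\ge 0$ of the disks contained in $A$, and write $\rho_n=\rho(\Lambda_n)$. Then $\rho(\Omega^-)<\infty$ and $$\liminf_{n\to\infty}\rho_n\ \ge\ \rho(\Omega^-)\quad\text{almost surely.}$$ If moreover $S\subseteq\Omega^-$, then $\rho_n\to\rho(\Omega^-)$ almost surely. -/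

import Mathlib

open MeasureTheory ProbabilityTheory Filter
open scoped ENNReal NNReal Topology

/-- The logarithm `log |z - w|` with its natural value `-∞` at `w = z`. -/
noncomputable def logDist (z w : ℂ) : EReal := ENNReal.log (edist z w)

/-- The logarithmic potential `U_μ(z) = ∫ log |z - w| dμ(w)`, as an extended real number: the
integral of the positive part minus the integral of the negative part. For a compactly supported
finite measure the positive part has a finite integral, so the value lies in `[-∞, ∞)`.
The support of `μ` has full measure, so integrating over `ℂ` or over the support is the same. -/
noncomputable def logPotential (μ : Measure ℂ) (z : ℂ) : EReal :=
  ((∫⁻ w, (logDist z w).toENNReal ∂μ : ℝ≥0∞) : EReal)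
    - ((∫⁻ w, (-logDist z w).toENNReal ∂μ : ℝ≥0∞) : EReal)

/-- The negative set `Ω⁻` of the logarithmic potential. -/
def negativeSet (μ : Measure ℂ) : Set ℂ := {z | logPotential μ z < 0}

/-- The square of `log |z - w|` is integrable in `w`, uniformly for `z` in each compact set. The
integrand has the value `∞` at `w = z`. -/
def LogSqBounded (μ : Measure ℂ) : Prop :=
  ∀ K : Set ℂ, IsCompact K → (⨆ z ∈ K, ∫⁻ w, (logDist z w).abs ^ 2 ∂μ) < ∞

/-- The polynomial `(z - x₀) ⋯ (z - xₙ₋₁)`. -/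
noncomputable def rootPoly (x : ℕ → ℂ) (n : ℕ) : Polynomial ℂ :=
  ∏ i ∈ Finset.range n, (Polynomial.X - Polynomial.C (x i))

/-- The filled lemniscate `{z : |p(z)| < 1}`. -/
def lemniscate (p : Polynomial ℂ) : Set ℂ := {z | ‖p.eval z‖ < 1}

/-- The inradius of a plane set: the supremum of the radii of the disks it contains. -/
noncomputable def inradius (A : Set ℂ) : ℝ≥0∞ :=
  ⨆ (z : ℂ) (r : ℝ≥0) (_ : Metric.ball z r ⊆ A), (r : ℝ≥0∞)

/-! Truncating the kernel at `log δ` makes the potential Lipschitz, and the truncated potentials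
decrease to `U_μ` as `δ → 0`. The strong law, applied at a countable dense set of points and at the
levels `δ = e^{-k}`, holds for all of them at once almost surely; everything after that is
deterministic. Lower bound: `log |p_n|` is at most the truncated sum, whose average becomes negative
near each point of `Ω⁻`. By compactness every closed disk in `Ω⁻` eventually lies in `Λ_n`. Upper
bound, when `S ⊆ Ω⁻`: an open disk not inside `Ω⁻` contains a point off `S` with `U_μ > 0`
(`subset_negativeSet_of_nonpos`, by the maximum principle and connectedness of the plane). At a
nearby dense point the truncation is inactive, so the strong law gives `|p_n| ≥ 1` eventually. A
finite net of disks makes this uniform. -/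

/-! ### Truncated potentials and the negative set. -/

/-- The logarithm of the distance, truncated from below at `log δ`. -/
noncomputable def truncLog (δ : ℝ) (z w : ℂ) : ℝ := Real.log (max (dist z w) δ)

/-- The potential of `μ` for the truncated logarithmic kernel. -/
noncomputable def truncPotential (μ : Measure ℂ) (δ : ℝ) (z : ℂ) : ℝ := ∫ w, truncLog δ z w ∂μ

/-- From `log (a / b) ≤ (a - b) / b` with `b ≥ δ`. -/
theorem truncLog_sub_le {δ : ℝ} (hδ : 0 < δ) (z z' w : ℂ) :
    truncLog δ z w - truncLog δ z' w ≤ dist z z' / δ := by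
  have ha : 0 < max (dist z w) δ := lt_max_of_lt_right hδ
  have hb : 0 < max (dist z' w) δ := lt_max_of_lt_right hδ
  have hsub : max (dist z w) δ - max (dist z' w) δ ≤ dist z z' := by
    have := dist_triangle z z' w
    have h0 : 0 ≤ dist z z' := dist_nonneg
    rw [sub_le_iff_le_add]
    refine max_le (this.trans (by gcongr; exact le_max_left _ _)) ?_
    linarith [le_max_right (dist z' w) δ]
  unfold truncLog
  rw [← Real.log_div ha.ne' hb.ne']
  refine (Real.log_le_sub_one_of_pos (div_pos ha hb)).trans ?_
  rw [div_sub_one hb.ne']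
  refine (div_le_div_of_nonneg_right hsub hb.le).trans ?_
  exact div_le_div_of_nonneg_left dist_nonneg hδ (le_max_right _ _)

theorem continuous_truncLog {δ : ℝ} (hδ : 0 < δ) (z : ℂ) : Continuous (truncLog δ z) := by
  unfold truncLog
  exact Continuous.log (by fun_prop) fun w => (lt_max_of_lt_right hδ).ne'

theorem truncLog_mono {δ δ' : ℝ} (hδ : 0 < δ) (h : δ ≤ δ') (z w : ℂ) :
    truncLog δ z w ≤ truncLog δ' z w :=
  Real.log_le_log (lt_max_of_lt_right hδ) (max_le_max_left _ h)

theorem integrable_of_continuousOn_support {E : Type*} [NormedAddCommGroup E]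
    {μ : Measure ℂ} [IsFiniteMeasure μ]
    (hμ : IsCompact μ.support) {f : ℂ → E} (hf : ContinuousOn f μ.support) :
    Integrable f μ := by
  have h := hf.integrableOn_compact (μ := μ) hμ
  have hae : ∀ᵐ w ∂μ, w ∈ μ.support := Measure.support_mem_ae
  rwa [IntegrableOn, Measure.restrict_eq_self_of_ae_mem hae] at h

theorem exists_exp_neg_nat_le {d : ℝ} (hd : 0 < d) : ∃ k : ℕ, Real.exp (-k) ≤ d := by
  obtain ⟨k, hk⟩ := exists_nat_ge (-Real.log d)
  exact ⟨k, (Real.le_log_iff_exp_le hd).1 (by linarith)⟩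

theorem truncPotential_eq_integral_log {μ : Measure ℂ} {δ : ℝ} {z : ℂ} (h : δ ≤ Metric.infDist z μ.support) :
    truncPotential μ δ z = ∫ w, Real.log (dist z w) ∂μ := by
  refine integral_congr_ae ?_
  filter_upwards [Measure.support_mem_ae (μ := μ)] with w hw
  rw [truncLog, max_eq_left (h.trans (Metric.infDist_le_dist_of_mem hw))]

section

variable {μ : Measure ℂ} [IsProbabilityMeasure μ]

theorem integrable_truncLog (hμ : IsCompact μ.support) {δ : ℝ} (hδ : 0 < δ) (z : ℂ) :
    Integrable (truncLog δ z) μ :=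
  integrable_of_continuousOn_support hμ (continuous_truncLog hδ z).continuousOn

theorem truncPotential_sub_le (hμ : IsCompact μ.support) {δ : ℝ} (hδ : 0 < δ) (z z' : ℂ) :
    truncPotential μ δ z - truncPotential μ δ z' ≤ dist z z' / δ := by
  unfold truncPotential
  rw [← integral_sub (integrable_truncLog hμ hδ z) (integrable_truncLog hμ hδ z')]
  calc _ ≤ ∫ _, dist z z' / δ ∂μ := integral_mono
        ((integrable_truncLog hμ hδ z).sub (integrable_truncLog hμ hδ z'))
        (integrable_const _) fun w => truncLog_sub_le hδ z z' w
    _ = _ := by simp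

theorem continuous_truncPotential (hμ : IsCompact μ.support) {δ : ℝ} (hδ : 0 < δ) :
    Continuous (truncPotential μ δ) := by
  refine (LipschitzWith.of_dist_le_mul (K := ⟨1 / δ, by positivity⟩) fun z z' => ?_).continuous
  change _ ≤ 1 / δ * dist z z'
  rw [Real.dist_eq, abs_le, one_div_mul_eq_div]
  have h1 := truncPotential_sub_le hμ hδ z z'
  have h2 := truncPotential_sub_le hμ hδ z' z
  rw [dist_comm] at h2
  constructor <;> linarith

theorem truncPotential_mono (hμ : IsCompact μ.support) {δ δ' : ℝ} (hδ : 0 < δ) (h : δ ≤ δ')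
    (z : ℂ) : truncPotential μ δ z ≤ truncPotential μ δ' z :=
  integral_mono (integrable_truncLog hμ hδ z) (integrable_truncLog hμ (hδ.trans_le h) z)
    fun w => truncLog_mono hδ h z w

theorem toENNReal_logDist {δ : ℝ} (hδ : 0 < δ) (h1 : δ ≤ 1) (z w : ℂ) :
    (logDist z w).toENNReal = ENNReal.ofReal (truncLog δ z w) := by
  unfold logDist truncLog
  rw [edist_dist]
  rcases (dist_nonneg (x := z) (y := w)).eq_or_lt with h | h
  · rw [← h, max_eq_right hδ.le, ENNReal.ofReal_of_nonpos (Real.log_nonpos hδ.le h1)]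
    simp
  · rw [ENNReal.log_ofReal_of_pos h, EReal.toENNReal_of_ne_top (EReal.coe_ne_top _),
      EReal.toReal_coe]
    rcases le_total δ (dist z w) with h2 | h2
    · rw [max_eq_left h2]
    · rw [max_eq_right h2, ENNReal.ofReal_of_nonpos (Real.log_nonpos hδ.le h1),
        ENNReal.ofReal_of_nonpos (Real.log_nonpos h.le (h2.trans h1))]

/-- Prepares monotone convergence. At `w = z` the `k`-th term is `k`, so the supremum is `∞` as
required. -/
theorem toENNReal_neg_logDist (z w : ℂ) :
    (-logDist z w).toENNReal =
      ⨆ k : ℕ, ENNReal.ofReal (-truncLog (Real.exp (-k)) z w) := by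
  unfold logDist
  rw [edist_dist]
  rcases (dist_nonneg (x := z) (y := w)).eq_or_lt with h | h
  · have : ∀ k : ℕ, ENNReal.ofReal (-truncLog (Real.exp (-k)) z w) = k := fun k => by
      unfold truncLog
      rw [← h, max_eq_right (Real.exp_pos _).le, Real.log_exp, neg_neg, ENNReal.ofReal_natCast]
    simp_rw [this, ENNReal.iSup_natCast, ← h]
    simp
  · rw [ENNReal.log_ofReal_of_pos h, ← EReal.coe_neg,
      EReal.toENNReal_of_ne_top (EReal.coe_ne_top _), EReal.toReal_coe]
    refine le_antisymm ?_ (iSup_le fun k => ENNReal.ofReal_le_ofReal (neg_le_neg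
      (Real.log_le_log h (le_max_left _ _))))
    obtain ⟨k, hk⟩ := exists_nat_ge (-Real.log (dist z w))
    refine le_iSup_of_le k ?_
    unfold truncLog
    rw [max_eq_left]
    rw [← Real.le_log_iff_exp_le h]
    linarith

/-- Truncation at `δ ≤ 1` leaves the positive part unchanged, and its integral is finite; the
negative part is an increasing limit. Hence strict negativity is already seen at a finite level. -/
theorem mem_negativeSet_iff (hμ : IsCompact μ.support) (z : ℂ) :
    z ∈ negativeSet μ ↔ ∃ k : ℕ, truncPotential μ (Real.exp (-k)) z < 0 := by
  have hδ : ∀ k : ℕ, 0 < Real.exp (-k) := fun k => Real.exp_pos _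
  have hδ1 : ∀ k : ℕ, Real.exp (-k) ≤ 1 := fun k => Real.exp_le_one_iff.2 (by simp)
  have hpos : ∀ k : ℕ, (∫⁻ w, (logDist z w).toENNReal ∂μ) =
      ∫⁻ w, ENNReal.ofReal (truncLog (Real.exp (-k)) z w) ∂μ := fun k =>
    lintegral_congr fun w => toENNReal_logDist (hδ k) (hδ1 k) z w
  have hneg : (∫⁻ w, (-logDist z w).toENNReal ∂μ) =
      ⨆ k : ℕ, ∫⁻ w, ENNReal.ofReal (-truncLog (Real.exp (-k)) z w) ∂μ := by
    simp_rw [toENNReal_neg_logDist]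
    refine lintegral_iSup (fun k => ?_) fun i j hij w => ?_
    · exact ((continuous_truncLog (hδ k) z).neg.measurable).ennreal_ofReal
    · exact ENNReal.ofReal_le_ofReal (neg_le_neg (truncLog_mono (hδ j)
        (Real.exp_le_exp.2 (neg_le_neg (Nat.cast_le.2 hij))) z w))
  have hposfin : ∀ k : ℕ, (∫⁻ w, ENNReal.ofReal (truncLog (Real.exp (-k)) z w) ∂μ) ≠ ∞ :=
    fun k => (integrable_truncLog hμ (hδ k) z).lintegral_lt_top.ne
  have hnegfin : ∀ k : ℕ, (∫⁻ w, ENNReal.ofReal (-truncLog (Real.exp (-k)) z w) ∂μ) ≠ ∞ :=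
    fun k => (integrable_truncLog hμ (hδ k) z).neg.lintegral_lt_top.ne
  unfold negativeSet logPotential
  rw [Set.mem_ofPred_eq, EReal.sub_neg, EReal.coe_ennreal_lt_coe_ennreal_iff, hneg, lt_iSup_iff]
  · refine exists_congr fun k => ?_
    rw [hpos k, truncPotential,
      integral_eq_lintegral_pos_part_sub_lintegral_neg_part (integrable_truncLog hμ (hδ k) z),
      _root_.sub_neg, ENNReal.toReal_lt_toReal (hposfin k) (hnegfin k)]
  · left
    rw [hpos 0]
    simpa using hposfin 0
  · left; simp

theorem isOpen_negativeSet (hμ : IsCompact μ.support) : IsOpen (negativeSet μ) := by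
  have : negativeSet μ = ⋃ k : ℕ, {z | truncPotential μ (Real.exp (-k)) z < 0} := by
    ext z
    simp [mem_negativeSet_iff hμ]
  rw [this]
  exact isOpen_iUnion fun k =>
    isOpen_lt (continuous_truncPotential hμ (Real.exp_pos _)) continuous_const

theorem infDist_support_pos {z : ℂ} (hz : z ∉ μ.support) : 0 < Metric.infDist z μ.support :=
  (Measure.isClosed_support.notMem_iff_infDist_pos
    (Measure.nonempty_support (IsProbabilityMeasure.ne_zero μ))).1 hz

theorem mem_negativeSet_iff_of_notMem_support (hμ : IsCompact μ.support) {z : ℂ}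
    (hz : z ∉ μ.support) : z ∈ negativeSet μ ↔ ∫ w, Real.log (dist z w) ∂μ < 0 := by
  obtain ⟨k, hk⟩ := exists_exp_neg_nat_le (infDist_support_pos hz)
  rw [mem_negativeSet_iff hμ]
  constructor
  · rintro ⟨l, hl⟩
    rw [← truncPotential_eq_integral_log ((min_le_left _ (Real.exp (-l))).trans hk)]
    exact (truncPotential_mono hμ (lt_min (Real.exp_pos _) (Real.exp_pos _))
      (min_le_right _ _) z).trans_lt hl
  · intro h
    exact ⟨k, by rwa [truncPotential_eq_integral_log hk]⟩

theorem negativeSet_subset_ball {R : ℝ} (hμ : IsCompact μ.support)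
    (hR : μ.support ⊆ Metric.closedBall 0 R) :
    negativeSet μ ⊆ Metric.ball 0 (R + 1) := by
  intro z hz
  by_contra hzR
  rw [Metric.mem_ball, not_lt] at hzR
  have hd : ∀ w ∈ μ.support, 1 ≤ dist z w := fun w hw => by
    have := dist_triangle z w 0
    have := Metric.mem_closedBall.1 (hR hw)
    linarith
  have hzS : z ∉ μ.support := fun h => by
    have := hd z h
    simp at this
    linarith
  refine absurd ((mem_negativeSet_iff_of_notMem_support hμ hzS).1 hz) (not_lt.2 ?_)
  refine integral_nonneg_of_ae ?_
  filter_upwards [Measure.support_mem_ae (μ := μ)] with w hw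
  exact Real.log_nonneg (hd w hw)

end

/-! ### Maximum principle off the support. -/

section

variable {μ : Measure ℂ} [IsProbabilityMeasure μ]

/-- Off the support, the logarithmic potential is locally the logarithm of the modulus of a
holomorphic function. -/
theorem exists_differentiableOn_norm_eq_exp_potential (hμ : IsCompact μ.support) {ζ : ℂ}
    (hζ : ζ ∉ μ.support) : ∃ d > 0, Metric.ball ζ d ⊆ μ.supportᶜ ∧ ∃ f : ℂ → ℂ,
      DifferentiableOn ℂ f (Metric.ball ζ d) ∧
      ∀ z ∈ Metric.ball ζ d, ‖f z‖ = Real.exp (∫ w, Real.log (dist z w) ∂μ) := by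
  set d := Metric.infDist ζ μ.support with hd
  have hd0 : 0 < d := infDist_support_pos hζ
  have hdw : ∀ w ∈ μ.support, d ≤ ‖ζ - w‖ := fun w hw => by
    rw [← dist_eq_norm]; exact Metric.infDist_le_dist_of_mem hw
  have hne : ∀ w ∈ μ.support, ζ - w ≠ 0 := fun w hw h => by
    have := hdw w hw
    rw [h, norm_zero] at this
    linarith
  have hquot : ∀ z ∈ Metric.ball ζ (d / 2), ∀ w ∈ μ.support, ‖(z - ζ) / (ζ - w)‖ < 1 / 2 := by
    intro z hz w hw
    have h1 := hdw w hw
    have h2 : ‖z - ζ‖ < d / 2 := by rw [← dist_eq_norm]; exact hz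
    rw [norm_div, div_lt_iff₀ (hd0.trans_le h1)]
    linarith
  have hslit : ∀ z ∈ Metric.ball ζ (d / 2), ∀ w ∈ μ.support,
      1 + (z - ζ) / (ζ - w) ∈ Complex.slitPlane := fun z hz w hw =>
    Complex.mem_slitPlane_of_norm_lt_one ((hquot z hz w hw).trans (by norm_num))
  have hcont : ∀ z, ContinuousOn (fun w => 1 + (z - ζ) / (ζ - w)) μ.support := fun z =>
    continuousOn_const.add (continuousOn_const.div (by fun_prop) hne)
  have hint : ∀ z ∈ Metric.ball ζ (d / 2),
      Integrable (fun w => Complex.log (1 + (z - ζ) / (ζ - w))) μ := fun z hz =>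
    integrable_of_continuousOn_support hμ ((hcont z).clog (hslit z hz))
  have hlogint : ∀ z ∉ μ.support, Integrable (fun w => Real.log (dist z w)) μ := fun z hz =>
    integrable_of_continuousOn_support hμ (ContinuousOn.log (by fun_prop) fun w hw =>
      dist_ne_zero.2 fun h => hz (h ▸ hw))
  have hball : Metric.ball ζ (d / 2) ⊆ μ.supportᶜ := fun z hz hzS => by
    have h1 := hdw z hzS
    rw [← dist_eq_norm, dist_comm] at h1
    have h2 : dist z ζ < d / 2 := hz
    linarith
  -- The ratio `(z - w) / (ζ - w) = 1 + (z - ζ) / (ζ - w)` is within `1 / 2` of `1`, so the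
  -- principal logarithm serves every `w` in the support at once; the added real constant restores
  -- the potential at `ζ`.
  refine ⟨d / 2, by positivity, hball, fun z => Complex.exp
    ((∫ w, Complex.log (1 + (z - ζ) / (ζ - w)) ∂μ) + (∫ w, Real.log (dist ζ w) ∂μ : ℝ)), ?_, ?_⟩
  · refine DifferentiableOn.cexp (DifferentiableOn.add_const _ fun z hz => ?_)
    have hder := (hasDerivAt_integral_of_dominated_loc_of_deriv_le (μ := μ) (𝕜 := ℂ)
      (F := fun z w => Complex.log (1 + (z - ζ) / (ζ - w)))
      (F' := fun z w => (1 / (ζ - w)) / (1 + (z - ζ) / (ζ - w)))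
      (x₀ := z) (s := Metric.ball ζ (d / 2)) (bound := fun _ => (1 / d) / (1 / 2))
      (Metric.isOpen_ball.mem_nhds hz) ?_ (hint z hz) ?_ ?_ (integrable_const _) ?_).2
    · exact hder.differentiableAt.differentiableWithinAt
    · filter_upwards [Metric.isOpen_ball.mem_nhds hz] with y hy
      exact (hint y hy).aestronglyMeasurable
    · exact Measurable.aestronglyMeasurable (by fun_prop)
    · filter_upwards [Measure.support_mem_ae (μ := μ)] with w hw y hy
      have h1 := hquot y hy w hw
      have h2 : 1 - ‖(y - ζ) / (ζ - w)‖ ≤ ‖1 + (y - ζ) / (ζ - w)‖ := by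
        have := norm_sub_le (1 + (y - ζ) / (ζ - w)) ((y - ζ) / (ζ - w))
        rw [add_sub_cancel_right, norm_one] at this
        linarith
      rw [norm_div, norm_div, norm_one]
      refine div_le_div₀ (by positivity) ?_ (by norm_num) (by linarith)
      exact div_le_div_of_nonneg_left zero_le_one hd0 (hdw w hw)
    · filter_upwards [Measure.support_mem_ae (μ := μ)] with w hw y hy
      refine HasDerivAt.clog ?_ (hslit y hy w hw)
      exact (((hasDerivAt_id y).sub_const ζ).div_const (ζ - w)).const_add 1
  · intro z hz
    rw [Complex.norm_exp, Complex.add_re, Complex.ofReal_re]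
    congr 1
    have hre : (∫ w, Complex.log (1 + (z - ζ) / (ζ - w)) ∂μ).re =
        ∫ w, (Complex.log (1 + (z - ζ) / (ζ - w))).re ∂μ :=
      (Complex.reCLM.integral_comp_comm (hint z hz)).symm
    have hintre : Integrable (fun w => (Complex.log (1 + (z - ζ) / (ζ - w))).re) μ := (hint z hz).re
    rw [hre, ← integral_add hintre (hlogint ζ hζ)]
    refine integral_congr_ae ?_
    filter_upwards [Measure.support_mem_ae (μ := μ)] with w hw
    have hzw : z - w ≠ 0 := sub_ne_zero.2 fun h => hball hz (h ▸ hw)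
    have hq : 1 + (z - ζ) / (ζ - w) = (z - w) / (ζ - w) := by
      have := hne w hw
      field_simp
      ring
    rw [Complex.log_re, hq, norm_div, dist_eq_norm, dist_eq_norm,
      Real.log_div (norm_ne_zero_iff.2 hzw) (norm_ne_zero_iff.2 (hne w hw))]
    ring

theorem continuousAt_potential (hμ : IsCompact μ.support) {z : ℂ} (hz : z ∉ μ.support) :
    ContinuousAt (fun z => ∫ w, Real.log (dist z w) ∂μ) z := by
  obtain ⟨d, hd, -, f, hf, hfz⟩ := exists_differentiableOn_norm_eq_exp_potential hμ hz
  have hfc : ContinuousAt f z := hf.continuousOn.continuousAt (Metric.ball_mem_nhds z hd)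
  have hne : ‖f z‖ ≠ 0 := by
    rw [hfz z (Metric.mem_ball_self hd)]
    exact (Real.exp_pos _).ne'
  refine (hfc.norm.log hne).congr ?_
  filter_upwards [Metric.ball_mem_nhds z hd] with y hy
  rw [hfz y hy, Real.log_exp]

/-- Maximum modulus principle for the local holomorphic function of modulus `exp U_μ`. -/
theorem potential_eventuallyEq_zero_of_eventually_nonpos (hμ : IsCompact μ.support) {z : ℂ}
    (hz : z ∉ μ.support) (h0 : ∫ w, Real.log (dist z w) ∂μ = 0)
    (hle : ∀ᶠ y in 𝓝 z, ∫ w, Real.log (dist y w) ∂μ ≤ 0) :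
    ∀ᶠ y in 𝓝 z, ∫ w, Real.log (dist y w) ∂μ = 0 := by
  obtain ⟨d, hd, -, f, hf, hfz⟩ := exists_differentiableOn_norm_eq_exp_potential hμ hz
  have hball := Metric.ball_mem_nhds z hd
  have hf1 : ‖f z‖ = 1 := by rw [hfz z (Metric.mem_ball_self hd), h0, Real.exp_zero]
  have hmax : IsLocalMax (norm ∘ f) z := by
    filter_upwards [hball, hle] with y hy hy0
    rw [Function.comp_apply, Function.comp_apply, hf1, hfz y hy]
    exact Real.exp_le_one_iff.2 hy0
  have hdiff : ∀ᶠ y in 𝓝 z, DifferentiableAt ℂ f y := by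
    filter_upwards [Metric.isOpen_ball.mem_nhds (Metric.mem_ball_self hd)] with y hy
    exact hf.differentiableAt (Metric.isOpen_ball.mem_nhds hy)
  filter_upwards [hball, Complex.eventually_eq_of_isLocalMax_norm hdiff hmax] with y hy hyz
  have := hfz y hy
  rwa [hyz, hf1, eq_comm, Real.exp_eq_one_iff] at this

/-- The local holomorphic function is constant near some point of the disk, hence on the whole disk
by the identity theorem. -/
theorem potential_eventuallyEq_zero_of_mem_closure (hμ : IsCompact μ.support) {z : ℂ}
    (hz : z ∉ μ.support)
    (hcl : z ∈ closure {y | ∀ᶠ x in 𝓝 y, ∫ w, Real.log (dist x w) ∂μ = 0}) :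
    ∀ᶠ y in 𝓝 z, ∫ w, Real.log (dist y w) ∂μ = 0 := by
  obtain ⟨d, hd, -, f, hf, hfz⟩ := exists_differentiableOn_norm_eq_exp_potential hμ hz
  have hball := Metric.ball_mem_nhds z hd
  obtain ⟨a, haB, ha⟩ := mem_closure_iff_nhds.1 hcl _ hball
  have hnhds := Metric.isOpen_ball.mem_nhds haB
  have hf1 : ∀ᶠ y in 𝓝 a, ‖f y‖ = 1 := by
    filter_upwards [hnhds, ha] with y hy hy0
    rw [hfz y hy, hy0, Real.exp_zero]
  have hmax : IsLocalMax (norm ∘ f) a := by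
    filter_upwards [hf1] with y hy
    exact (hy.trans hf1.self_of_nhds.symm).le
  have hdiff : ∀ᶠ y in 𝓝 a, DifferentiableAt ℂ f y := by
    filter_upwards [hnhds] with y hy
    exact hf.differentiableAt (Metric.isOpen_ball.mem_nhds hy)
  have heq : Set.EqOn f (fun _ => f a) (Metric.ball z d) :=
    (hf.analyticOnNhd Metric.isOpen_ball).eqOn_of_preconnected_of_eventuallyEq
      analyticOnNhd_const (convex_ball z d).isPreconnected haB
      (Complex.eventually_eq_of_isLocalMax_norm hdiff hmax)
  filter_upwards [hball] with y hy
  have := hfz y hy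
  rwa [heq hy, hf1.self_of_nhds, eq_comm, Real.exp_eq_one_iff] at this

/-- If the support lies in the negative set, an open set on which the potential is nonpositive
lies in the negative set as well. -/
theorem subset_negativeSet_of_nonpos (hμ : IsCompact μ.support)
    (hS : μ.support ⊆ negativeSet μ) {B : Set ℂ} (hB : IsOpen B)
    (hle : ∀ z ∈ B, z ∉ μ.support → ∫ w, Real.log (dist z w) ∂μ ≤ 0) :
    B ⊆ negativeSet μ := by
  intro z hzB
  by_contra hz
  have hzS : z ∉ μ.support := fun h => hz (hS h)
  -- `A` is shown to be clopen: its closure misses the open set `Ω⁻`, hence the support, so the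
  -- identity theorem applies at every limit point. Then `A` is the whole plane, contradicting `S ≠
  -- ∅`.
  let A := {y | ∀ᶠ x in 𝓝 y, x ∉ μ.support ∧ ∫ w, Real.log (dist x w) ∂μ = 0}
  have hzA : z ∈ A := by
    refine Eventually.and (Measure.isClosed_support.isOpen_compl.mem_nhds hzS)
      (potential_eventuallyEq_zero_of_eventually_nonpos hμ hzS ?_ ?_)
    · exact le_antisymm (hle z hzB hzS)
        (not_lt.1 ((mem_negativeSet_iff_of_notMem_support hμ hzS).not.1 hz))
    · filter_upwards [hB.mem_nhds hzB, Measure.isClosed_support.isOpen_compl.mem_nhds hzS]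
        with y hy hyS using hle y hy hyS
  have hdisj : ∀ y ∈ closure A, y ∉ negativeSet μ := by
    intro y hy hyneg
    obtain ⟨a, haneg, ha⟩ := mem_closure_iff_nhds.1 hy _
      ((isOpen_negativeSet hμ).mem_nhds hyneg)
    obtain ⟨haS, ha0⟩ := ha.self_of_nhds
    exact ((mem_negativeSet_iff_of_notMem_support hμ haS).1 haneg).ne ha0
  have hclosed : IsClosed A := by
    refine isClosed_of_closure_subset fun y hy => ?_
    have hyS : y ∉ μ.support := fun h => hdisj y hy (hS h)
    exact Eventually.and (Measure.isClosed_support.isOpen_compl.mem_nhds hyS)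
      (potential_eventuallyEq_zero_of_mem_closure hμ hyS
        (closure_mono (fun a ha => ha.mono fun _ h => h.2) hy))
  have hopen : IsOpen A := isOpen_setOfPred_eventually_nhds
  have huniv : A = Set.univ := IsClopen.eq_univ ⟨hclosed, hopen⟩ ⟨z, hzA⟩
  obtain ⟨s, hs⟩ := Measure.nonempty_support (IsProbabilityMeasure.ne_zero μ)
  exact hdisj s (subset_closure (huniv ▸ Set.mem_univ s)) (hS hs)

end

/-! ### Reduction to deterministic sequences. -/

/-- The deterministic properties of a sequence of roots that the asymptotics of the inradius need;
almost every i.i.d. sequence has them. -/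
structure IsTypicalSequence (μ : Measure ℂ) (x : ℕ → ℂ) : Prop where
  mem_support : ∀ i, x i ∈ μ.support
  tendsto_average : ∀ j k : ℕ, Tendsto (fun n : ℕ =>
    (∑ i ∈ Finset.range n, truncLog (Real.exp (-k)) (TopologicalSpace.denseSeq ℂ j) (x i)) / n)
    atTop (𝓝 (truncPotential μ (Real.exp (-k)) (TopologicalSpace.denseSeq ℂ j)))

theorem ae_isTypicalSequence {Ω : Type*} [MeasurableSpace Ω] {P : Measure Ω}
    {μ : Measure ℂ} [IsProbabilityMeasure μ] (hμ : IsCompact μ.support)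
    {X : ℕ → Ω → ℂ} (hX : ∀ i, Measurable (X i)) (hlaw : ∀ i, P.map (X i) = μ)
    (hindep : iIndepFun X P) : ∀ᵐ ω ∂P, IsTypicalSequence μ fun i => X i ω := by
  have hmem : ∀ᵐ ω ∂P, ∀ i, X i ω ∈ μ.support := by
    refine ae_all_iff.2 fun i => ae_of_ae_map (hX i).aemeasurable ?_
    rw [hlaw i]
    exact Measure.support_mem_ae
  have hslln : ∀ᵐ ω ∂P, ∀ j k : ℕ, Tendsto (fun n : ℕ =>
      (∑ i ∈ Finset.range n, truncLog (Real.exp (-k)) (TopologicalSpace.denseSeq ℂ j) (X i ω)) / n)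
      atTop (𝓝 (truncPotential μ (Real.exp (-k)) (TopologicalSpace.denseSeq ℂ j))) := by
    refine ae_all_iff.2 fun j => ae_all_iff.2 fun k => ?_
    set q := TopologicalSpace.denseSeq ℂ j
    have hcont := continuous_truncLog (Real.exp_pos (-(k : ℝ))) q
    have hint := integrable_truncLog hμ (Real.exp_pos (-(k : ℝ))) q
    have hmean : truncPotential μ (Real.exp (-k)) q =
        ∫ ω, truncLog (Real.exp (-k)) q (X 0 ω) ∂P := by
      rw [truncPotential, ← hlaw 0,
        integral_map (hX 0).aemeasurable hcont.aestronglyMeasurable]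
    rw [hmean]
    refine strong_law_ae_real (fun i ω => truncLog (Real.exp (-k)) q (X i ω)) ?_ ?_ ?_
    · rw [← hlaw 0] at hint
      exact hint.comp_measurable (hX 0)
    · exact fun i l hil => (hindep.indepFun hil).comp hcont.measurable hcont.measurable
    · intro i
      have hid : IdentDistrib (X i) (X 0) P P :=
        ⟨(hX i).aemeasurable, (hX 0).aemeasurable, by rw [hlaw, hlaw]⟩
      exact hid.comp hcont.measurable
  filter_upwards [hmem, hslln] with ω h1 h2 using ⟨h1, h2⟩

/-! ### Lemniscates and inradii. -/

theorem norm_eval_rootPoly (x : ℕ → ℂ) (n : ℕ) (z : ℂ) :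
    ‖(rootPoly x n).eval z‖ = ∏ i ∈ Finset.range n, dist z (x i) := by
  simp [rootPoly, Polynomial.eval_prod, dist_eq_norm]

theorem norm_eval_rootPoly_le_exp {δ : ℝ} (hδ : 0 < δ) (x : ℕ → ℂ) (n : ℕ) (z : ℂ) :
    ‖(rootPoly x n).eval z‖ ≤ Real.exp (∑ i ∈ Finset.range n, truncLog δ z (x i)) := by
  rw [norm_eval_rootPoly, Real.exp_sum]
  refine Finset.prod_le_prod (fun _ _ => dist_nonneg) fun i _ => ?_
  rw [truncLog, Real.exp_log (lt_max_of_lt_right hδ)]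
  exact le_max_left _ _

theorem norm_eval_rootPoly_eq_exp {δ : ℝ} (hδ : 0 < δ) {x : ℕ → ℂ} {z : ℂ}
    (hx : ∀ i, δ ≤ dist z (x i)) (n : ℕ) :
    ‖(rootPoly x n).eval z‖ = Real.exp (∑ i ∈ Finset.range n, truncLog δ z (x i)) := by
  rw [norm_eval_rootPoly, Real.exp_sum]
  refine Finset.prod_congr rfl fun i _ => ?_
  rw [truncLog, Real.exp_log (lt_max_of_lt_right hδ), max_eq_left (hx i)]

theorem notMem_lemniscate_iff {p : Polynomial ℂ} {z : ℂ} :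
    z ∉ lemniscate p ↔ 1 ≤ ‖p.eval z‖ := by
  simp [lemniscate]

theorem coe_le_inradius {A : Set ℂ} {z : ℂ} {r : ℝ≥0} (h : Metric.ball z r ⊆ A) :
    (r : ℝ≥0∞) ≤ inradius A :=
  le_iSup_of_le z (le_iSup_of_le r (le_iSup_of_le h le_rfl))

/-- Comparing areas bounds every inscribed radius by `R`. -/
theorem inradius_lt_top_of_subset_ball {A : Set ℂ} {c : ℂ} {R : ℝ} (h : A ⊆ Metric.ball c R) :
    inradius A < ∞ := by
  refine lt_of_le_of_lt (b := ENNReal.ofReal R) ?_ ENNReal.ofReal_lt_top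
  refine iSup_le fun z => iSup_le fun r => iSup_le fun hz => ?_
  rcases eq_or_ne r 0 with rfl | hr
  · simp
  have hr : (0 : ℝ) < r := by exact_mod_cast pos_iff_ne_zero.2 hr
  have hsub : Metric.ball z r ⊆ Metric.ball c R := hz.trans h
  have hR : 0 < R := dist_nonneg.trans_lt (hsub (Metric.mem_ball_self hr))
  have hvol := measure_mono (μ := (volume : Measure ℂ)) hsub
  rw [Complex.volume_ball, Complex.volume_ball, ENNReal.ofReal_coe_nnreal] at hvol
  have := (ENNReal.mul_le_mul_iff_left (by simp [NNReal.pi_ne_zero]) (by simp)).1 hvol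
  exact (ENNReal.pow_le_pow_left_iff two_ne_zero).1 this

theorem lemniscate_rootPoly_subset_ball {x : ℕ → ℂ} {R : ℝ} (hx : ∀ i, x i ∈ Metric.closedBall 0 R)
    (n : ℕ) : lemniscate (rootPoly x n) ⊆ Metric.ball 0 (R + 1) := by
  intro z hz
  by_contra hzR
  rw [Metric.mem_ball, not_lt] at hzR
  refine absurd hz (notMem_lemniscate_iff.2 ?_)
  rw [norm_eval_rootPoly]
  refine Finset.prod_induction _ (1 ≤ ·) (fun _ _ => one_le_mul_of_one_le_of_one_le) le_rfl fun i _ => ?_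
  have := dist_triangle z (x i) 0
  have := Metric.mem_closedBall.1 (hx i)
  linarith

/-! ### Asymptotics of the inradius. -/

section

variable {μ : Measure ℂ} [IsProbabilityMeasure μ] {x : ℕ → ℂ}

theorem IsTypicalSequence.eventually_mem_lemniscate (hx : IsTypicalSequence μ x)
    (hμ : IsCompact μ.support) {z : ℂ} (hz : z ∈ negativeSet μ) :
    ∀ᶠ p : ℕ × ℂ in atTop ×ˢ 𝓝 z, p.2 ∈ lemniscate (rootPoly x p.1) := by
  obtain ⟨k, hk⟩ := (mem_negativeSet_iff hμ z).1 hz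
  set δ := Real.exp (-k) with hδ
  have hδ0 : 0 < δ := Real.exp_pos _
  -- The truncated potential is `-4η` at `z` and below `-3η` at `q`; the averages at `q` are
  -- eventually below `-2η`, and passing from `q` to `y` costs at most `η`.
  set η := -truncPotential μ δ z / 4 with hη
  have hη0 : 0 < η := by linarith
  have hηδ : 0 < η * δ := mul_pos hη0 hδ0
  obtain ⟨j, hq⟩ := (TopologicalSpace.denseRange_denseSeq ℂ).exists_dist_lt z hηδ
  set q := TopologicalSpace.denseSeq ℂ j with hqj
  have hVq : truncPotential μ δ q < -2 * η := by
    have h1 := truncPotential_sub_le hμ hδ0 q z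
    have h2 : dist q z / δ < η := by rwa [div_lt_iff₀ hδ0, dist_comm]
    linarith
  have hev := (hx.tendsto_average j k).eventually_lt_const hVq
  have hnear : ∀ᶠ y in 𝓝 z, dist y q < η * δ :=
    (continuous_id.dist continuous_const).continuousAt.eventually_lt_const hq
  filter_upwards [(hev.and (eventually_gt_atTop 0)).prod_mk hnear] with ⟨n, y⟩ ⟨⟨hn, hn0⟩, hy⟩
  have hn0' : (0 : ℝ) < n := Nat.cast_pos.2 hn0
  refine (norm_eval_rootPoly_le_exp hδ0 x n y).trans_lt (Real.exp_lt_one_iff.2 ?_)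
  rw [div_lt_iff₀ hn0'] at hn
  have hsum : ∑ i ∈ Finset.range n, truncLog δ y (x i) ≤
      ∑ i ∈ Finset.range n, (truncLog δ q (x i) + η) := by
    refine Finset.sum_le_sum fun i _ => ?_
    have h1 := truncLog_sub_le hδ0 y q (x i)
    have h2 : dist y q / δ < η := by rwa [div_lt_iff₀ hδ0]
    linarith
  rw [Finset.sum_add_distrib, Finset.sum_const, Finset.card_range, nsmul_eq_mul] at hsum
  nlinarith

theorem IsTypicalSequence.eventually_subset_lemniscate (hx : IsTypicalSequence μ x)
    (hμ : IsCompact μ.support) {K : Set ℂ} (hK : IsCompact K) (hKneg : K ⊆ negativeSet μ) :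
    ∀ᶠ n in atTop, K ⊆ lemniscate (rootPoly x n) := by
  have : ∀ᶠ p : ℕ × ℂ in atTop ×ˢ 𝓝ˢ K, p.2 ∈ lemniscate (rootPoly x p.1) := by
    rw [hK.prod_nhdsSet_eq_biSup]
    simpa only [eventually_iSup] using fun z hz => hx.eventually_mem_lemniscate hμ (hKneg hz)
  exact this.curry.mono fun n hn y hy => hn.self_of_nhdsSet y hy

theorem IsTypicalSequence.inradius_le_liminf (hx : IsTypicalSequence μ x)
    (hμ : IsCompact μ.support) :
    inradius (negativeSet μ) ≤ liminf (fun n => inradius (lemniscate (rootPoly x n))) atTop := by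
  refine iSup_le fun z => iSup_le fun r => iSup_le fun hz => ?_
  refine le_of_forall_lt fun a ha => ?_
  obtain ⟨s, has, hsr⟩ := ENNReal.lt_iff_exists_nnreal_btwn.1 ha
  refine has.trans_le (le_liminf_of_le (by isBoundedDefault) ?_)
  have hsub : Metric.closedBall z s ⊆ negativeSet μ :=
    (Metric.closedBall_subset_ball (by exact_mod_cast hsr)).trans hz
  filter_upwards [hx.eventually_subset_lemniscate hμ (isCompact_closedBall z s) hsub] with n hn
  exact coe_le_inradius (Metric.ball_subset_closedBall.trans hn)

theorem IsTypicalSequence.exists_eventually_notMem_lemniscate (hx : IsTypicalSequence μ x)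
    (hμ : IsCompact μ.support) (hS : μ.support ⊆ negativeSet μ) {B : Set ℂ} (hB : IsOpen B)
    (hBneg : ¬ B ⊆ negativeSet μ) :
    ∃ q ∈ B, ∀ᶠ n in atTop, q ∉ lemniscate (rootPoly x n) := by
  have hex : ∃ z ∈ B, z ∉ μ.support ∧ 0 < ∫ w, Real.log (dist z w) ∂μ := by
    by_contra! h
    exact hBneg (subset_negativeSet_of_nonpos hμ hS hB h)
  obtain ⟨z, hzB, hzS, hz⟩ := hex
  have hnhds : {y | y ∈ B ∧ y ∉ μ.support ∧ 0 < ∫ w, Real.log (dist y w) ∂μ} ∈ 𝓝 z := by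
    filter_upwards [hB.mem_nhds hzB, Measure.isClosed_support.isOpen_compl.mem_nhds hzS,
      (continuousAt_potential hμ hzS).eventually_const_lt hz] with y h1 h2 h3 using ⟨h1, h2, h3⟩
  obtain ⟨_, ⟨hqB, hqS, hq⟩, j, rfl⟩ :=
    mem_closure_iff_nhds.1 (TopologicalSpace.denseRange_denseSeq ℂ z) _ hnhds
  refine ⟨_, hqB, ?_⟩
  obtain ⟨k, hk⟩ := exists_exp_neg_nat_le (infDist_support_pos hqS)
  rw [← truncPotential_eq_integral_log hk] at hq
  filter_upwards [(hx.tendsto_average j k).eventually_const_lt hq, eventually_gt_atTop 0]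
    with n hn hn0
  have hsum := (div_pos_iff_of_pos_right (Nat.cast_pos.2 hn0)).1 hn
  refine notMem_lemniscate_iff.2 ?_
  rw [norm_eval_rootPoly_eq_exp (Real.exp_pos _)
    (fun i => hk.trans (Metric.infDist_le_dist_of_mem (hx.mem_support i)))]
  exact Real.one_le_exp hsum.le

theorem IsTypicalSequence.limsup_le_inradius (hx : IsTypicalSequence μ x)
    (hμ : IsCompact μ.support) (hS : μ.support ⊆ negativeSet μ) :
    limsup (fun n => inradius (lemniscate (rootPoly x n))) atTop ≤ inradius (negativeSet μ) := by
  refine le_of_forall_gt fun b hb => ?_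
  obtain ⟨t, hrt, htb⟩ := ENNReal.lt_iff_exists_nnreal_btwn.1 hb
  obtain ⟨s, hrs, hst⟩ := ENNReal.lt_iff_exists_nnreal_btwn.1 hrt
  have hst' : (s : ℝ) < t := by exact_mod_cast hst
  refine lt_of_le_of_lt (limsup_le_of_le (by isBoundedDefault) ?_) htb
  obtain ⟨R, hR⟩ := hμ.isBounded.subset_closedBall 0
  -- With mesh `t - s`, a disk of radius above `t` centred in the large disk contains the radius-`s`
  -- disk about some net point. Since `s` exceeds the inradius of `Ω⁻`, none of these finitely many
  -- disks lies in `Ω⁻`.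
  obtain ⟨C, -, hCfin, hC⟩ :=
    (isCompact_closedBall (0 : ℂ) (R + 1)).finite_cover_balls (sub_pos.2 hst')
  have hev : ∀ᶠ n in atTop, ∀ c ∈ C, ¬ Metric.ball c s ⊆ lemniscate (rootPoly x n) := by
    refine (eventually_all_finite hCfin).2 fun c _ => ?_
    obtain ⟨q, hq, hqn⟩ := hx.exists_eventually_notMem_lemniscate hμ hS
      (Metric.isOpen_ball (x := c) (ε := s)) fun h => (coe_le_inradius h).not_gt hrs
    exact hqn.mono fun n hn h => hn (h hq)
  filter_upwards [hev] with n hn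
  refine iSup_le fun z => iSup_le fun r => iSup_le fun hz => ?_
  by_contra! htr
  have htr' : (t : ℝ) < r := by exact_mod_cast htr
  have hzR := lemniscate_rootPoly_subset_ball (fun i => hR (hx.mem_support i)) n
    (hz (Metric.mem_ball_self (t.2.trans_lt htr')))
  obtain ⟨c, hcC, hc⟩ := Set.mem_iUnion₂.1 (hC (Metric.ball_subset_closedBall hzR))
  refine hn c hcC (subset_trans (Metric.ball_subset_ball' ?_) hz)
  rw [Metric.mem_ball, dist_comm] at hc
  linarith

end

theorem corollary2 {Ω : Type*} [MeasurableSpace Ω] (P : Measure Ω) [IsProbabilityMeasure P]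
    (μ : Measure ℂ) [IsProbabilityMeasure μ] (hcompact : IsCompact μ.support)
    (hA : LogSqBounded μ) (hneg : (negativeSet μ).Nonempty)
    (X : ℕ → Ω → ℂ) (hX : ∀ i, Measurable (X i)) (hlaw : ∀ i, P.map (X i) = μ)
    (hindep : iIndepFun X P) :
    inradius (negativeSet μ) < ∞ ∧
    (∀ᵐ ω ∂P, inradius (negativeSet μ) ≤
      liminf (fun n : ℕ => inradius (lemniscate (rootPoly (fun i => X i ω) n))) atTop) ∧
    (μ.support ⊆ negativeSet μ →
      ∀ᵐ ω ∂P, Tendsto (fun n : ℕ => inradius (lemniscate (rootPoly (fun i => X i ω) n)))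
        atTop (𝓝 (inradius (negativeSet μ)))) := by
  have htyp := ae_isTypicalSequence hcompact hX hlaw hindep
  obtain ⟨R, hR⟩ := hcompact.isBounded.subset_closedBall 0
  refine ⟨inradius_lt_top_of_subset_ball (negativeSet_subset_ball hcompact hR), ?_, fun hS => ?_⟩
  · filter_upwards [htyp] with ω hω using hω.inradius_le_liminf hcompact
  · filter_upwards [htyp] with ω hω
    exact tendsto_of_le_liminf_of_limsup_le (hω.inradius_le_liminf hcompact)
      (hω.limsup_le_inradius hcompact hS)
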